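/- Let $t \ge 3$ be an integer. Let $\bar a_1, \bar a_2, \bar a_3 \in \mathbb{R}\setminus\{0\}$ with pairwise distinct exponent vectors $\bar b^1, \bar b^2, \bar b^3 \in \mathbb{R}^2$, and let $a_1, \ldots, a_t \in \mathbb{R}\setminus\{0\}$ with pairwise distinct exponent vectors $b^1, \ldots, b^t \in \mathbb{R}^2$. For $x = (x_1,x_2)$ with $x_1, x_2 > 0$ and $y \in \mathbb{R}^2$, write $x^y = x_1^{y_1} x_2^{y_2}$. Consider the system consisting of one trinomial and one $t$-nomial equation in two variables with real exponents, \[ \sum_{j=1}^{3} \bar a_j \, x^{\bar b^j} = 0 , \qquad \sum_{j=1}^{t} a_j \, x^{b^j} = 0 . \] Then the number of (distinct) positive solutions $x = (x_1,x_2)$, $x_1>0$, $x_2>0$, is either infinite or at most \[ \frac{1}{3} t^3 - t^2 + \frac{8}{3} t - 2 . \] -/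

import Mathlib

/-- The generalized monomial `x ^ y = ∏ i, x i ^ y i` with real exponent vector `y`
(meant for vectors `x` with positive entries). -/
noncomputable def genMonomial {n : ℕ} (x y : Fin n → ℝ) : ℝ :=
  ∏ i, x i ^ y i

/-- The generalized polynomial function `x ↦ ∑ j, a j * x ^ (b j)` with coefficients `a j` and
exponent vectors `b j`. -/
noncomputable def genPolynomial {n t : ℕ} (a : Fin t → ℝ) (b : Fin t → Fin n → ℝ)
    (x : Fin n → ℝ) : ℝ :=
  ∑ j, a j * genMonomial x (b j)

/-- `IsNomial a b` says that the data `a`, `b` define a genuine `t`-nomial in `n` variables with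
real exponents: all `t` coefficients are nonzero and the `t` exponent vectors are distinct. -/
def IsNomial {n t : ℕ} (a : Fin t → ℝ) (b : Fin t → Fin n → ℝ) : Prop :=
  (∀ j, a j ≠ 0) ∧ Function.Injective b

/-- The set of positive solutions of the system of two equations
`∑ j, a' j * x ^ (b' j) = 0` and `∑ j, a j * x ^ (b j) = 0`. -/
def positiveSolutions {n s t : ℕ} (a' : Fin s → ℝ) (b' : Fin s → Fin n → ℝ)
    (a : Fin t → ℝ) (b : Fin t → Fin n → ℝ) : Set (Fin n → ℝ) :=
  {x | (∀ i, 0 < x i) ∧ genPolynomial a' b' x = 0 ∧ genPolynomial a b x = 0}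

/-!
If the exponent differences of the trinomial are linearly independent, logarithmic coordinates turn
its positive zero set into a curve on which two monomials are, up to positive constants, `s` and
`1 - s` with `0 < s < 1` (unless all the coefficients have the same sign and there is no solution).
On this curve the `t`-nomial becomes a combination `F` of `t` functions `s ^ α * (1 - s) ^ β`, and
the problem is to bound the zeros of `F`. The parameter used is `τ ∈ ℝ` with `s = Real.sigmoid τ`.

The count goes through Wronskians. With `W_m = W(g_0, …, g_{m-1})` and
`L_m = W(g_0, …, g_{m-1}, F)`, so that `L_0 = F`, the determinant identity
`L_m' * W_{m+1} - L_m * W_{m+1}' = W_m * L_{m+1}` (`seqWronskian_mul_seqWronskian`) and a sharp form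
of Rolle's theorem (`encard_zeros_le_of_differentiable`) give
`Z(L_m) ≤ 1 + Z(W_{m+1}) + Z(W_m) + Z(L_{m+1})`, where `Z` is the number of zeros. For `g` one takes
a maximal chain of functions from the family whose Wronskians do not vanish identically; then some
`L_m` vanishes identically, and for the first such `m` either `F = 0` or `L_{m-1}` is a nonzero
multiple of `W_m`, which ends the recursion (`encard_zeros_sum_le`).

Each derivative of `s ^ α * (1 - s) ^ β` in `τ` is a polynomial in `s` times the function, the
degree being at most the order. Hence `W_m` is a zero-free function times a polynomial in `s` of
degree at most `m * (m - 1) / 2`, and the sum of these bounds is the cubic in `t`.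

If the exponents of the trinomial are collinear, it has at most two zeros as a function of a single
monomial. On each level set of that monomial the `t`-nomial is an exponential sum in one variable,
where the Wronskians either vanish identically or have no zeros; so it has at most `t - 1` zeros or
is identically zero.
-/

/-! ### A Rolle-type count for a pair of functions -/

/-- A form of Rolle's theorem for the quotient `f / g`, whose derivative has numerator
`f' * g - f * g'`. The zeros of `g` are charged only once: a zero of `g` that is also a zero of `f`
breaks the argument on both of its sides, but it is a zero of the numerator as well. -/
theorem encard_zeros_le_of_differentiable {f g : ℝ → ℝ} (hf : Differentiable ℝ f)
    (hg : Differentiable ℝ g) :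
    {x | f x = 0}.encard ≤
      {x | g x = 0}.encard + {x | deriv f x * g x - f x * deriv g x = 0}.encard + 1 := by
  set G : Set ℝ := {x | g x = 0} with hG
  set H : Set ℝ := {x | deriv f x * g x - f x * deriv g x = 0} with hH
  have key : ∀ s : Finset ℝ, (∀ x ∈ s, f x = 0) → ∀ M ∈ s, (∀ x ∈ s, x ≤ M) →
      (s.card : ℕ∞) ≤ (G ∩ Set.Iio M).encard + (H ∩ Set.Iic M).encard + 1 := by
    intro s
    induction s using Finset.induction_on_max with
    | empty => intro _ M hM; simp at hM
    | insert b s hb ih =>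
      intro hz M hM hmax
      have hMb : M = b := by
        rcases Finset.mem_insert.1 hM with h | h
        · exact h
        · exact absurd (hmax b (Finset.mem_insert_self _ _)) (not_le.2 (hb M h))
      subst hMb
      have hns : M ∉ s := fun h => lt_irrefl _ (hb M h)
      rw [Finset.card_insert_of_notMem hns]
      rcases s.eq_empty_or_nonempty with rfl | hne
      · simp
      set z := s.max' hne with hzdef
      have hzs : z ∈ s := s.max'_mem hne
      have hzM : z < M := hb z hzs
      have hfz : f z = 0 := hz z (Finset.mem_insert_of_mem hzs)
      have hfM : f M = 0 := hz M (Finset.mem_insert_self _ _)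
      have ih' := ih (fun x hx => hz x (Finset.mem_insert_of_mem hx)) z hzs
        (fun x hx => s.le_max' x hx)
      have hGsub : G ∩ Set.Iio z ⊆ G ∩ Set.Iio M :=
        fun x hx => ⟨hx.1, lt_trans hx.2 hzM⟩
      have hHsub : H ∩ Set.Iic z ⊆ H ∩ Set.Iic M :=
        fun x hx => ⟨hx.1, le_trans hx.2 hzM.le⟩
      -- Between consecutive zeros `z < M` of `f`, a new zero of `g` or of the numerator appears.
      have hnew : (∃ w ∈ G, z ≤ w ∧ w < M) ∨ (∃ w ∈ H, z < w ∧ w ≤ M) := by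
        by_contra! hcon
        obtain ⟨h1, h2⟩ := hcon
        have hgM : g M ≠ 0 := by
          intro h0
          refine absurd (h2 M ?_ hzM) (lt_irrefl _)
          simp [hH, h0, hfM]
        have hgne : ∀ x ∈ Set.Icc z M, g x ≠ 0 := by
          intro x hx h0
          rcases hx.2.lt_or_eq with h | h
          · exact absurd (h1 x h0 hx.1) (not_le.2 h)
          · exact hgM (h ▸ h0)
        obtain ⟨c, hc, hc0⟩ := exists_deriv_eq_zero (f := fun x => f x / g x) hzM
          (hf.continuous.continuousOn.div hg.continuous.continuousOn hgne)
          (by simp [hfz, hfM])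
        have hgc := hgne c ⟨hc.1.le, hc.2.le⟩
        rw [deriv_fun_div (hf c) (hg c) hgc, div_eq_zero_iff] at hc0
        have hcH : c ∈ H := hc0.resolve_right (pow_ne_zero 2 hgc)
        exact absurd (h2 c hcH hc.1) (not_lt.2 hc.2.le)
      push_cast
      gcongr ?_ + 1
      refine ih'.trans ?_
      rcases hnew with ⟨w, hw, hzw, hwM⟩ | ⟨w, hw, hzw, hwM⟩
      · have : insert w (G ∩ Set.Iio z) ⊆ G ∩ Set.Iio M :=
          Set.insert_subset ⟨hw, hwM⟩ hGsub
        have h3 := Set.encard_le_encard this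
        rw [Set.encard_insert_of_notMem (fun h => not_lt.2 hzw h.2)] at h3
        calc _ = ((G ∩ Set.Iio z).encard + 1) + (H ∩ Set.Iic z).encard := by ring
          _ ≤ _ := add_le_add h3 (Set.encard_le_encard hHsub)
      · have : insert w (H ∩ Set.Iic z) ⊆ H ∩ Set.Iic M :=
          Set.insert_subset ⟨hw, hwM⟩ hHsub
        have h3 := Set.encard_le_encard this
        rw [Set.encard_insert_of_notMem (fun h => not_le.2 hzw h.2)] at h3
        calc _ = (G ∩ Set.Iio z).encard + ((H ∩ Set.Iic z).encard + 1) := by ring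
          _ ≤ _ := add_le_add (Set.encard_le_encard hGsub) h3
  have key' : ∀ s : Finset ℝ, (s : Set ℝ) ⊆ {x | f x = 0} →
      (s.card : ℕ∞) ≤ G.encard + H.encard + 1 := by
    intro s hs
    rcases s.eq_empty_or_nonempty with rfl | hne
    · simp
    · refine (key s (fun x hx => hs hx) _ (s.max'_mem hne) (fun x hx => s.le_max' x hx)).trans ?_
      gcongr <;> exact Set.inter_subset_left
  by_contra! hlt
  obtain ⟨u, hu, hucard⟩ := Set.exists_subset_encard_eq (Order.add_one_le_of_lt hlt)
  have hfin : G.encard + H.encard + 1 ≠ ⊤ := hlt.ne_top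
  have hufin : u.Finite := by
    rw [← Set.encard_ne_top_iff, hucard]
    exact (ENat.add_lt_top.2 ⟨hfin.lt_top, ENat.one_lt_top⟩).ne
  have h4 := key' hufin.toFinset (by simpa using hu)
  rw [← hufin.encard_eq_coe_toFinset_card, hucard] at h4
  exact absurd h4 (not_le.2 ((ENat.lt_add_one_iff hfin).2 le_rfl))

/-! ### Wronskians of sequences of functions -/

/-- The Wronskian at `x` of the first `m` members of the sequence `g` of real functions. -/
noncomputable def seqWronskian (g : ℕ → ℝ → ℝ) (m : ℕ) (x : ℝ) : ℝ :=
  (Matrix.of fun i j : Fin m => iteratedDeriv i (g j) x).det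

/-- The minor of the array `D` on the first `m` rows and columns, bordered by row `p` and
column `q`. -/
def borderedMinor (m : ℕ) (D : ℕ → ℕ → ℝ) (p q : ℕ) : ℝ :=
  (Matrix.of fun i j : Fin (m + 1) =>
    D (if (i : ℕ) < m then i else p) (if (j : ℕ) < m then j else q)).det

theorem borderedMinor_eq {m : ℕ} {D : ℕ → ℕ → ℝ} {A : Matrix (Fin m) (Fin m) ℝ}
    (hA : A = Matrix.of fun i j : Fin m => D i j) (h : A.det ≠ 0) (p q : ℕ) :
    borderedMinor m D p q =
      A.det * (D p q - ∑ j : Fin m, (∑ i : Fin m, D p i * A⁻¹ i j) * D j q) := by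
  classical
  let _ : Invertible A := A.invertibleOfIsUnitDet (isUnit_iff_ne_zero.2 h)
  have h1 : borderedMinor m D p q =
      (Matrix.fromBlocks A (Matrix.of fun i (_ : Fin 1) => D i q)
        (Matrix.of fun (_ : Fin 1) j => D p j) (Matrix.of fun _ _ => D p q)).det := by
    rw [borderedMinor, ← Matrix.det_submatrix_equiv_self (finSumFinEquiv (m := m) (n := 1))]
    congr 1
    ext (i | i) (j | j) <;> simp [hA]
  rw [h1, Matrix.det_fromBlocks₁₁]
  simp [Matrix.mul_apply]

/-- The Desnanot-Jacobi identity for the last two rows and columns, in the case where the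
complementary minor is nonzero, by Schur complements. -/
theorem det_mul_det_eq_borderedMinor {m : ℕ} {D : ℕ → ℕ → ℝ}
    (h : (Matrix.of fun i j : Fin m => D i j).det ≠ 0) :
    (Matrix.of fun i j : Fin m => D i j).det * (Matrix.of fun i j : Fin (m + 2) => D i j).det =
      borderedMinor m D m m * borderedMinor m D (m + 1) (m + 1) -
        borderedMinor m D m (m + 1) * borderedMinor m D (m + 1) m := by
  classical
  simp only [borderedMinor_eq rfl h]
  set A : Matrix (Fin m) (Fin m) ℝ := Matrix.of fun i j : Fin m => D i j with hA
  let _ : Invertible A := A.invertibleOfIsUnitDet (isUnit_iff_ne_zero.2 h)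
  have h1 : (Matrix.of fun i j : Fin (m + 2) => D i j).det =
      (Matrix.fromBlocks A (Matrix.of fun i (k : Fin 2) => D i (m + k))
        (Matrix.of fun (k : Fin 2) j => D (m + k) j)
        (Matrix.of fun k l : Fin 2 => D (m + k) (m + l))).det := by
    rw [← Matrix.det_submatrix_equiv_self (finSumFinEquiv (m := m) (n := 2))]
    congr 1
    ext (i | i) (j | j) <;> simp [hA]
  rw [h1, Matrix.det_fromBlocks₁₁, Matrix.det_fin_two]
  simp only [Matrix.sub_apply, Matrix.of_apply, Matrix.mul_apply, Matrix.invOf_eq_nonsing_inv,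
    Fin.val_zero, Fin.val_one, add_zero]
  ring

theorem hasDerivAt_det {n : Type*} [Fintype n] [DecidableEq n] {M : ℝ → Matrix n n ℝ}
    {M' : Matrix n n ℝ} {x : ℝ} (h : ∀ i j, HasDerivAt (fun y => M y i j) (M' i j) x) :
    HasDerivAt (fun y => (M y).det) (∑ i, ((M x).updateRow i (M' i)).det) x := by
  simp only [← Matrix.det_transpose (M _), ← Matrix.det_transpose (Matrix.updateRow _ _ _)]
  simp only [Matrix.det_apply, Matrix.transpose_apply]
  rw [Finset.sum_comm]
  refine HasDerivAt.fun_sum fun σ _ => ?_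
  rw [← Finset.smul_sum]
  refine HasDerivAt.const_smul (Equiv.Perm.sign σ) ?_
  refine (HasDerivAt.fun_finsetProd (u := Finset.univ)
    (fun i _ => h i (σ i))).congr_deriv ?_
  refine Finset.sum_congr rfl fun i _ => ?_
  rw [← Finset.prod_erase_mul _ _ (Finset.mem_univ i), smul_eq_mul, Matrix.updateRow_self]
  congr 1
  refine Finset.prod_congr rfl fun k hk => ?_
  rw [Matrix.updateRow_ne (Finset.ne_of_mem_erase hk)]

/-- Differentiating a Wronskian raises the order of the derivatives in its last row; the other
terms of the derivative of the determinant have two equal rows. -/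
theorem hasDerivAt_borderedMinor_iteratedDeriv {g : ℕ → ℝ → ℝ}
    (hg : ∀ j, AnalyticOnNhd ℝ (g j) Set.univ) (m q : ℕ) (x : ℝ) :
    HasDerivAt (fun y => borderedMinor m (fun i j => iteratedDeriv i (g j) y) m q)
      (borderedMinor m (fun i j => iteratedDeriv i (g j) x) (m + 1) q) x := by
  have hd : ∀ i j, HasDerivAt (iteratedDeriv i (g j)) (iteratedDeriv (i + 1) (g j) x) x := by
    intro i j
    rw [iteratedDeriv_succ]
    refine DifferentiableAt.hasDerivAt ?_
    rw [iteratedDeriv_eq_iterate]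
    exact ((hg j).iterated_deriv i).differentiableOn.differentiableAt Filter.univ_mem
  refine (hasDerivAt_det
    (M := fun y => Matrix.of fun i j : Fin (m + 1) => iteratedDeriv
      (if (i : ℕ) < m then i else m) (g (if (j : ℕ) < m then j else q)) y)
    (M' := Matrix.of fun i j : Fin (m + 1) => iteratedDeriv
      ((if (i : ℕ) < m then (i : ℕ) else m) + 1) (g (if (j : ℕ) < m then j else q)) x)
    (fun i j => hd _ _)).congr_deriv ?_
  rw [Fin.sum_univ_castSucc, Finset.sum_eq_zero, zero_add]
  · rw [borderedMinor]
    congr 1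
    ext i j
    refine Fin.lastCases ?_ (fun i => ?_) i
    · simp
    · rw [Matrix.updateRow_ne (Fin.castSucc_lt_last i).ne]
      simp
  · intro i _
    refine Matrix.det_zero_of_row_eq (i := i.castSucc) (j := i.succ)
      Fin.castSucc_lt_succ.ne ?_
    ext j
    rw [Matrix.updateRow_self, Matrix.updateRow_ne Fin.castSucc_lt_succ.ne']
    simp only [Fin.val_castSucc, Matrix.of_apply, Fin.val_succ, i.isLt, if_true]
    congr 1
    split_ifs <;> omega

theorem seqWronskian_update (g : ℕ → ℝ → ℝ) (F : ℝ → ℝ) (m q : ℕ) (hq : m ≤ q) :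
    seqWronskian (Function.update g m F) (m + 1) =
      fun x => borderedMinor m
        (fun i j => iteratedDeriv i (Function.update g q F j) x) m q := by
  ext x
  rw [seqWronskian, borderedMinor]
  congr 1
  ext i j
  have hi : (if (i : ℕ) < m then (i : ℕ) else m) = i := by split_ifs <;> omega
  simp only [Matrix.of_apply, hi]
  congr 1
  split_ifs with h
  · rw [Function.update_of_ne h.ne, Function.update_of_ne (by omega)]
  · have : (j : ℕ) = m := by omega
    rw [this, Function.update_self, Function.update_self]

theorem seqWronskian_congr {g h : ℕ → ℝ → ℝ} {m : ℕ} (hgh : ∀ j < m, g j = h j) :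
    seqWronskian g m = seqWronskian h m := by
  ext x
  rw [seqWronskian, seqWronskian]
  congr 1
  ext i j
  simp only [Matrix.of_apply, hgh j j.isLt]

theorem analyticOnNhd_update {g : ℕ → ℝ → ℝ} {F : ℝ → ℝ}
    (hg : ∀ j, AnalyticOnNhd ℝ (g j) Set.univ) (hF : AnalyticOnNhd ℝ F Set.univ) (m j : ℕ) :
    AnalyticOnNhd ℝ (Function.update g m F j) Set.univ := by
  rcases eq_or_ne j m with rfl | hj
  · simpa using hF
  · simpa [Function.update_of_ne hj] using hg j

theorem analyticOnNhd_seqWronskian {g : ℕ → ℝ → ℝ}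
    (hg : ∀ j, AnalyticOnNhd ℝ (g j) Set.univ) (m : ℕ) :
    AnalyticOnNhd ℝ (seqWronskian g m) Set.univ := by
  have : seqWronskian g m = fun x => ∑ σ : Equiv.Perm (Fin m), ((Equiv.Perm.sign σ : ℤ) : ℝ) *
      ∏ i : Fin m, iteratedDeriv (σ i) (g i) x := by
    ext x
    rw [seqWronskian, Matrix.det_apply']
    simp
  rw [this]
  refine Finset.analyticOnNhd_fun_sum _ fun σ _ => ?_
  refine analyticOnNhd_const.mul (Finset.analyticOnNhd_fun_prod _ fun i _ => ?_)
  rw [iteratedDeriv_eq_iterate]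
  exact (hg _).iterated_deriv _

/-- The Wronskian identity behind the zero count: up to the factor `W_{m+1} ^ 2`, the derivative of
the quotient of `W(g_0, …, g_{m-1}, F)` by `W(g_0, …, g_m)` is
`W(g_0, …, g_{m-1}) * W(g_0, …, g_m, F)`. -/
theorem seqWronskian_mul_seqWronskian {g : ℕ → ℝ → ℝ} {F : ℝ → ℝ}
    (hg : ∀ j, AnalyticOnNhd ℝ (g j) Set.univ) (hF : AnalyticOnNhd ℝ F Set.univ) {m : ℕ} {x : ℝ}
    (h : seqWronskian g m x ≠ 0) :
    deriv (seqWronskian (Function.update g m F) (m + 1)) x * seqWronskian g (m + 1) x -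
        seqWronskian (Function.update g m F) (m + 1) x * deriv (seqWronskian g (m + 1)) x =
      seqWronskian g m x * seqWronskian (Function.update g (m + 1) F) (m + 2) x := by
  set k := Function.update g (m + 1) F with hk
  have hka : ∀ j, AnalyticOnNhd ℝ (k j) Set.univ := analyticOnNhd_update hg hF (m + 1)
  have h1 := seqWronskian_update g F m (m + 1) (Nat.le_succ m)
  have h2 : seqWronskian g (m + 1) =
      fun x => borderedMinor m (fun i j => iteratedDeriv i (k j) x) m m := by
    have := seqWronskian_update k (k m) m m le_rfl
    rw [Function.update_eq_self] at this
    rw [← this]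
    exact seqWronskian_congr fun j hj => (Function.update_of_ne (by omega) _ _).symm
  have h3 : seqWronskian g m = seqWronskian k m :=
    seqWronskian_congr fun j hj => (Function.update_of_ne (by omega) _ _).symm
  rw [h3] at h ⊢
  rw [h1, h2, (hasDerivAt_borderedMinor_iteratedDeriv hka m m x).deriv,
    (hasDerivAt_borderedMinor_iteratedDeriv hka m (m + 1) x).deriv]
  have h4 := det_mul_det_eq_borderedMinor (D := fun i j => iteratedDeriv i (k j) x) h
  rw [seqWronskian, seqWronskian, h4]
  ring

theorem seqWronskian_update_sum {ι : Type*} [Fintype ι] (g : ℕ → ℝ → ℝ) (f : ι → ℝ → ℝ)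
    (hf : ∀ j, AnalyticOnNhd ℝ (f j) Set.univ) (a : ι → ℝ) (m : ℕ) (x : ℝ) :
    seqWronskian (Function.update g m fun x => ∑ j, a j * f j x) (m + 1) x =
      ∑ j, a j * seqWronskian (Function.update g m (f j)) (m + 1) x := by
  have hcd : ∀ (j : ι) (i : ℕ), ContDiffAt ℝ i (f j) x := fun j i =>
    ((hf j) x (Set.mem_univ x)).contDiffAt
  have hcol : ∀ (F : ℝ → ℝ) (i : Fin (m + 1)) (j : Fin m),
      iteratedDeriv i (Function.update g m F j.castSucc) x = iteratedDeriv i (g j) x := by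
    intro F i j
    rw [Fin.val_castSucc, Function.update_of_ne j.isLt.ne]
  simp only [seqWronskian, Matrix.det_succ_column _ (Fin.last m), Matrix.of_apply, Fin.val_last,
    Function.update_self, Finset.mul_sum]
  rw [Finset.sum_comm]
  refine Finset.sum_congr rfl fun i _ => ?_
  have hs : iteratedDeriv i (fun x => ∑ j, a j * f j x) x =
      ∑ j, a j * iteratedDeriv i (f j) x := by
    rw [iteratedDeriv_fun_sum fun j _ => contDiffAt_const.mul (hcd j i)]
    refine Finset.sum_congr rfl fun j _ => ?_
    rw [iteratedDeriv_const_mul_field]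
  rw [hs, Finset.mul_sum, Finset.sum_mul]
  refine Finset.sum_congr rfl fun j _ => ?_
  have hsub : ∀ F : ℝ → ℝ, (Matrix.of fun i j : Fin (m + 1) =>
      iteratedDeriv i (Function.update g m F j) x).submatrix i.succAbove
        (Fin.last m).succAbove =
      Matrix.of fun k l : Fin m => iteratedDeriv (i.succAbove k) (g l) x := by
    intro F
    ext k l
    simp only [Matrix.submatrix_apply, Matrix.of_apply, Fin.succAbove_last, hcol]
  rw [hsub, hsub]
  ring

/-! ### Zeros of linear combinations -/

theorem exists_eq_const_mul_of_seqWronskian_eq_zero {g : ℕ → ℝ → ℝ} {F : ℝ → ℝ}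
    (hg : ∀ j, AnalyticOnNhd ℝ (g j) Set.univ) (hF : AnalyticOnNhd ℝ F Set.univ) {m : ℕ}
    (h : ∃ x, seqWronskian g m x ≠ 0 ∧ seqWronskian g (m + 1) x ≠ 0)
    (h0 : seqWronskian (Function.update g (m + 1) F) (m + 2) = 0) :
    ∃ c, ∀ x, seqWronskian (Function.update g m F) (m + 1) x = c * seqWronskian g (m + 1) x := by
  obtain ⟨x₀, hx₀, hx₀'⟩ := h
  have hupd := analyticOnNhd_update hg hF m
  set L := seqWronskian (Function.update g m F) (m + 1) with hL
  set V := seqWronskian g m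
  set W := seqWronskian g (m + 1)
  have hVa : AnalyticOnNhd ℝ V Set.univ := analyticOnNhd_seqWronskian hg _
  have hWa : AnalyticOnNhd ℝ W Set.univ := analyticOnNhd_seqWronskian hg _
  have hLa : AnalyticOnNhd ℝ L Set.univ := analyticOnNhd_seqWronskian hupd _
  have hev : ∀ᶠ x in nhds x₀, V x ≠ 0 ∧ W x ≠ 0 :=
    ((hVa x₀ trivial).continuousAt.eventually_ne hx₀).and
      ((hWa x₀ trivial).continuousAt.eventually_ne hx₀')
  obtain ⟨ε, hε, hball⟩ := Metric.eventually_nhds_iff_ball.1 hev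
  obtain ⟨c, hc⟩ := Metric.isOpen_ball.exists_is_const_of_deriv_eq_zero
    (f := fun x => L x / W x) (convex_ball x₀ ε).isPreconnected
    (fun x hx => ((hLa x trivial).differentiableAt.div (hWa x trivial).differentiableAt
      (hball x hx).2).differentiableWithinAt)
    (fun x hx => by
      rw [deriv_fun_div (hLa x trivial).differentiableAt (hWa x trivial).differentiableAt
        (hball x hx).2, hL, seqWronskian_mul_seqWronskian hg hF (hball x hx).1, h0]
      simp)
  refine ⟨c, fun x => ?_⟩
  refine congrFun (hLa.eq_of_eventuallyEq (g := fun x => c * W x) (analyticOnNhd_const.mul hWa)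
    (z₀ := x₀) ?_) x
  filter_upwards [Metric.ball_mem_nhds x₀ hε] with y hy
  exact (div_eq_iff (hball y hy).2).1 (hc y hy)

theorem seqWronskian_zero (g : ℕ → ℝ → ℝ) (x : ℝ) : seqWronskian g 0 x = 1 := by
  simp [seqWronskian]

theorem seqWronskian_one (g : ℕ → ℝ → ℝ) (x : ℝ) : seqWronskian g 1 x = g 0 x := by
  simp [seqWronskian]

theorem encard_zeros_seqWronskian_update_le {g : ℕ → ℝ → ℝ} {F : ℝ → ℝ}
    (hg : ∀ j, AnalyticOnNhd ℝ (g j) Set.univ) (hF : AnalyticOnNhd ℝ F Set.univ) (m : ℕ) :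
    {x | seqWronskian (Function.update g m F) (m + 1) x = 0}.encard ≤
      {x | seqWronskian g (m + 1) x = 0}.encard + ({x | seqWronskian g m x = 0}.encard +
        {x | seqWronskian (Function.update g (m + 1) F) (m + 2) x = 0}.encard) + 1 := by
  have hupd := analyticOnNhd_update hg hF m
  refine (encard_zeros_le_of_differentiable
    (fun x => ((analyticOnNhd_seqWronskian hupd _) x trivial).differentiableAt)
    (fun x => ((analyticOnNhd_seqWronskian hg (m + 1)) x trivial).differentiableAt)).trans ?_
  gcongr
  refine (Set.encard_le_encard ?_).trans (Set.encard_union_le _ _)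
  intro x hx
  by_cases h : seqWronskian g m x = 0
  · exact Or.inl h
  · refine Or.inr ?_
    rw [Set.mem_ofPred_eq, seqWronskian_mul_seqWronskian hg hF h] at hx
    exact (mul_eq_zero.1 hx).resolve_left h

/-- If each Wronskian of members of a finite family of analytic functions vanishes identically or
has at most `d m` zeros, `m` being the number of functions, then a linear combination of the family
is zero or has an explicitly bounded number of zeros. -/
theorem encard_zeros_sum_le {ι : Type*} [Fintype ι] [Nonempty ι] {f : ι → ℝ → ℝ}
    (hf : ∀ j, AnalyticOnNhd ℝ (f j) Set.univ) (d : ℕ → ℕ)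
    (hd : ∀ (σ : ℕ → ι) (m : ℕ), seqWronskian (fun j => f (σ j)) m = 0 ∨
      {x | seqWronskian (fun j => f (σ j)) m x = 0}.encard ≤ d m)
    (a : ι → ℝ) :
    (∀ x, ∑ j, a j * f j x = 0) ∨ ∃ k < Fintype.card ι,
      {x | ∑ j, a j * f j x = 0}.encard ≤
        ((∑ i ∈ Finset.range k, (1 + d (i + 1) + d i) + d (k + 1) : ℕ) : ℕ∞) := by
  classical
  -- A maximal chain of nonzero Wronskians; adjoining any member of the family kills the last one.
  obtain ⟨k, σ, hk, hσ, hmax⟩ : ∃ (k : ℕ) (σ : ℕ → ι), k ≤ Fintype.card ι ∧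
      (∀ m ≤ k, seqWronskian (fun j => f (σ j)) m ≠ 0) ∧
      ∀ j, seqWronskian (Function.update (fun j => f (σ j)) k (f j)) (k + 1) = 0 := by
    let P : ℕ → Prop := fun k => ∃ σ : ℕ → ι, ∀ m ≤ k, seqWronskian (fun j => f (σ j)) m ≠ 0
    have hP0 : P 0 := by
      refine ⟨fun _ => Classical.arbitrary ι, fun m hm h => ?_⟩
      obtain rfl : m = 0 := by omega
      have := congrFun h 0
      rw [seqWronskian_zero] at this
      exact one_ne_zero this
    have hPle : ∀ k, P k → k ≤ Fintype.card ι := by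
      rintro k ⟨σ, hσ⟩
      by_contra! hlt
      obtain ⟨i, j, hij, hσij⟩ := Fintype.exists_ne_map_eq_of_card_lt
        (fun i : Fin k => σ i) (by simpa using hlt)
      refine hσ k le_rfl (funext fun x => Matrix.det_zero_of_column_eq hij fun l => ?_)
      simp only [Matrix.of_apply, hσij]
    obtain ⟨k, ⟨σ, hσ⟩, hnot⟩ : ∃ k, P k ∧ ¬ P (k + 1) := by
      by_contra! hcon
      have hall : ∀ k, P k := fun k => Nat.rec hP0 hcon k
      have := hPle _ (hall (Fintype.card ι + 1))
      omega
    refine ⟨k, σ, hPle k ⟨σ, hσ⟩, hσ, fun j => ?_⟩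
    by_contra hne
    refine hnot ⟨Function.update σ k j, fun m hm => ?_⟩
    rcases Nat.lt_or_ge m (k + 1) with hlt | hge
    · rw [seqWronskian_congr (h := fun j => f (σ j))]
      · exact hσ m (by omega)
      · intro i hi
        rw [Function.update_of_ne (by omega)]
    · obtain rfl : m = k + 1 := by omega
      rw [seqWronskian_congr (h := Function.update (fun j => f (σ j)) k (f j))]
      · exact hne
      · intro i hi
        rcases eq_or_ne i k with rfl | hik
        · simp
        · simp [Function.update_of_ne hik]
  set g : ℕ → ℝ → ℝ := fun j => f (σ j) with hgdef
  have hg : ∀ j, AnalyticOnNhd ℝ (g j) Set.univ := fun j => hf _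
  set F : ℝ → ℝ := fun x => ∑ j, a j * f j x with hFdef
  have hF : AnalyticOnNhd ℝ F Set.univ :=
    Finset.analyticOnNhd_fun_sum _ fun j _ => analyticOnNhd_const.mul (hf j)
  have hLk : seqWronskian (Function.update g k F) (k + 1) = 0 := by
    ext x
    rw [seqWronskian_update_sum g f hf a k x]
    simp [hmax]
  have hex : ∃ m, seqWronskian (Function.update g m F) (m + 1) = 0 := ⟨k, hLk⟩
  have hfind := Nat.find_spec hex
  have hmin : ∀ m < Nat.find hex, _ := fun m hm => Nat.find_min hex hm
  have hfk : Nat.find hex ≤ k := Nat.find_min' hex hLk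
  rcases hm : Nat.find hex with _ | m
  · left
    intro x
    rw [hm] at hfind
    have := congrFun hfind x
    rwa [seqWronskian_one, Function.update_self] at this
  right
  rw [hm] at hfind hmin hfk
  have hWfin : ∀ n ≤ k, {x | seqWronskian g n x = 0}.encard ≤ d n := fun n hn =>
    (hd σ n).resolve_left (hσ n hn)
  have hne : ∃ x, seqWronskian g m x ≠ 0 ∧ seqWronskian g (m + 1) x ≠ 0 := by
    have h1 := Set.finite_of_encard_le_coe (hWfin m (by omega))
    have h2 := Set.finite_of_encard_le_coe (hWfin (m + 1) hfk)
    obtain ⟨x, hx⟩ := (h1.union h2).infinite_compl.nonempty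
    exact ⟨x, fun h => hx (Or.inl h), fun h => hx (Or.inr h)⟩
  obtain ⟨c, hc⟩ := exists_eq_const_mul_of_seqWronskian_eq_zero hg hF hne hfind
  have hc0 : c ≠ 0 := by
    rintro rfl
    exact hmin m (Nat.lt_succ_self m) (funext fun x => by rw [hc x, zero_mul]; rfl)
  have hchain : ∀ i n, n + i = m →
      {x | seqWronskian (Function.update g n F) (n + 1) x = 0}.encard ≤
        ((∑ i ∈ Finset.Ico n m, (1 + d (i + 1) + d i) + d (m + 1) : ℕ) : ℕ∞) := by
    intro i
    induction i with
    | zero =>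
      rintro n rfl
      simp only [add_zero] at hc hWfin ⊢
      rw [Finset.Ico_self, Finset.sum_empty, zero_add]
      refine le_trans (Set.encard_le_encard fun x hx => ?_) (hWfin (n + 1) (by simpa using hfk))
      rw [Set.mem_ofPred_eq, hc x] at hx
      exact (mul_eq_zero.1 hx).resolve_left hc0
    | succ i ih =>
      intro n hn
      refine (encard_zeros_seqWronskian_update_le hg hF n).trans ?_
      rw [Finset.sum_eq_sum_Ico_succ_bot (by omega)]
      have h1 := hWfin (n + 1) (by omega)
      have h2 := hWfin n (by omega)
      have h3 := ih (n + 1) (by omega)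
      calc _ ≤ (d (n + 1) : ℕ∞) + (d n + ((∑ i ∈ Finset.Ico (n + 1) m, (1 + d (i + 1) + d i) +
              d (m + 1) : ℕ) : ℕ∞)) + 1 := by gcongr
        _ = _ := by push_cast; ring
  refine ⟨m, by omega, ?_⟩
  have h0 := hchain m 0 (by omega)
  rw [Nat.Ico_zero_eq_range] at h0
  simpa [seqWronskian_one] using h0

/-! ### Products of powers of the sigmoid function and its complement -/

/-- The function `s ^ α * (1 - s) ^ β` in the parameter `τ`, where `s = Real.sigmoid τ` runs
through the interval `(0, 1)` and `1 - s = Real.sigmoid (-τ)`. -/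
noncomputable def sigmoidMonomial (α β τ : ℝ) : ℝ :=
  Real.exp (α * Real.log (Real.sigmoid τ) + β * Real.log (Real.sigmoid (-τ)))

/-- The polynomial `q` for which the `i`-th derivative of `sigmoidMonomial α β` is `q(s)` times the
function itself, `s` being the sigmoid function, whose derivative is `s * (1 - s)`. -/
noncomputable def sigmoidJet (α β : ℝ) : ℕ → Polynomial ℝ
  | 0 => 1
  | i + 1 => Polynomial.X * (1 - Polynomial.X) * (sigmoidJet α β i).derivative +
      (Polynomial.C α * (1 - Polynomial.X) - Polynomial.C β * Polynomial.X) * sigmoidJet α β i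

theorem analyticOnNhd_sigmoidMonomial (α β : ℝ) :
    AnalyticOnNhd ℝ (sigmoidMonomial α β) Set.univ := by
  intro τ _
  refine AnalyticAt.rexp (f := fun τ => α * Real.log (Real.sigmoid τ) +
    β * Real.log (Real.sigmoid (-τ))) ?_
  refine (analyticAt_const.mul ?_).add (analyticAt_const.mul ?_)
  · exact analyticAt_sigmoid.log (Real.sigmoid_pos _)
  · exact (AnalyticAt.sigmoid' analyticAt_id.neg).log (Real.sigmoid_pos _)

theorem hasDerivAt_sigmoidMonomial (α β τ : ℝ) :
    HasDerivAt (sigmoidMonomial α β)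
      ((α * (1 - Real.sigmoid τ) - β * Real.sigmoid τ) * sigmoidMonomial α β τ) τ := by
  have h1 := (Real.hasDerivAt_sigmoid τ).log (Real.sigmoid_pos τ).ne'
  have h2 := ((Real.hasDerivAt_sigmoid (-τ)).comp τ (hasDerivAt_neg τ)).log (Real.sigmoid_pos (-τ)).ne'
  refine (((h1.const_mul α).add (h2.const_mul β)).exp).congr_deriv ?_
  have h3 := (Real.sigmoid_pos τ).ne'
  have h4 := (Real.sigmoid_pos (-τ)).ne'
  simp only [Function.comp_apply] at h4 ⊢
  rw [mul_comm, sigmoidMonomial]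
  simp only [Pi.add_apply]
  congr 1
  rw [Real.sigmoid_neg] at h4 ⊢
  field_simp
  ring

theorem iteratedDeriv_sigmoidMonomial (α β : ℝ) (i : ℕ) :
    iteratedDeriv i (sigmoidMonomial α β) =
      fun τ => (sigmoidJet α β i).eval (Real.sigmoid τ) * sigmoidMonomial α β τ := by
  induction i with
  | zero => ext τ; simp [sigmoidJet]
  | succ i ih =>
    ext τ
    rw [iteratedDeriv_succ, ih]
    have h1 := ((sigmoidJet α β i).hasDerivAt (Real.sigmoid τ)).comp τ (Real.hasDerivAt_sigmoid τ)
    refine (h1.mul (hasDerivAt_sigmoidMonomial α β τ)).deriv.trans ?_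
    simp only [sigmoidJet, Polynomial.eval_add, Polynomial.eval_mul, Polynomial.eval_sub,
      Polynomial.eval_C, Polynomial.eval_X, Polynomial.eval_one, Function.comp_apply]
    ring

theorem natDegree_sigmoidJet_le (α β : ℝ) (i : ℕ) : (sigmoidJet α β i).natDegree ≤ i := by
  induction i with
  | zero => simp [sigmoidJet]
  | succ i ih =>
    have hX : (1 - Polynomial.X : Polynomial ℝ).natDegree ≤ 1 := by compute_degree
    have hl : (Polynomial.C α * (1 - Polynomial.X) - Polynomial.C β * Polynomial.X).natDegree ≤ 1 := by
      compute_degree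
    rw [sigmoidJet]
    refine Polynomial.natDegree_add_le_of_degree_le ?_ ?_
    · rcases Nat.eq_zero_or_pos i with rfl | hi
      · simp [sigmoidJet]
      · have hd := Polynomial.natDegree_derivative_le (sigmoidJet α β i)
        have hXX : (Polynomial.X * (1 - Polynomial.X) : Polynomial ℝ).natDegree ≤ 2 :=
          Polynomial.natDegree_mul_le_of_le Polynomial.natDegree_X_le hX
        refine (Polynomial.natDegree_mul_le_of_le hXX (hd.trans (Nat.sub_le_sub_right ih 1))).trans ?_
        omega
    · refine (Polynomial.natDegree_mul_le_of_le hl ih).trans ?_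
      omega

/-- For `β = -α` the function is `τ ↦ exp (α * τ)`, so that all the jets are constant. -/
theorem natDegree_sigmoidJet_neg (α : ℝ) (i : ℕ) : (sigmoidJet α (-α) i).natDegree ≤ 0 := by
  have : sigmoidJet α (-α) i = Polynomial.C (α ^ i) := by
    induction i with
    | zero => simp [sigmoidJet]
    | succ i ih =>
      rw [sigmoidJet, ih, Polynomial.derivative_C, pow_succ, Polynomial.C_mul, Polynomial.C_neg]
      ring
  rw [this, Polynomial.natDegree_C]

theorem sigmoidMonomial_neg (α τ : ℝ) : sigmoidMonomial α (-α) τ = Real.exp (α * τ) := by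
  have h := Real.sigmoid_mul_rexp_neg τ
  rw [sigmoidMonomial, ← h, Real.log_mul (Real.sigmoid_pos τ).ne' (Real.exp_ne_zero _),
    Real.log_exp]
  congr 1
  ring

/-- A Wronskian of `sigmoidMonomial`s is a zero-free function times a polynomial in the
sigmoid function. -/
theorem seqWronskian_sigmoidMonomial_eq_zero_or {α β : ℕ → ℝ} {e : ℕ → ℕ}
    (he : ∀ i j, (sigmoidJet (α j) (β j) i).natDegree ≤ e i) (m : ℕ) :
    seqWronskian (fun j => sigmoidMonomial (α j) (β j)) m = 0 ∨
      {x | seqWronskian (fun j => sigmoidMonomial (α j) (β j)) m x = 0}.encard ≤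
        ((∑ i ∈ Finset.range m, e i : ℕ) : ℕ∞) := by
  set Q : Polynomial ℝ :=
    (Matrix.of fun i j : Fin m => sigmoidJet (α j) (β j) i).det with hQ
  have hW : ∀ τ, seqWronskian (fun j => sigmoidMonomial (α j) (β j)) m τ =
      (∏ j : Fin m, sigmoidMonomial (α j) (β j) τ) * Q.eval (Real.sigmoid τ) := by
    intro τ
    rw [hQ, ← Polynomial.coe_evalRingHom, RingHom.map_det, ← Matrix.det_mul_row, seqWronskian]
    congr 1
    ext i j
    simp [iteratedDeriv_sigmoidMonomial, mul_comm]
  have hprod : ∀ τ, ∏ j : Fin m, sigmoidMonomial (α j) (β j) τ ≠ 0 := fun τ =>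
    Finset.prod_ne_zero_iff.2 fun j _ => Real.exp_ne_zero _
  have hdeg : Q.natDegree ≤ ∑ i ∈ Finset.range m, e i := by
    rw [hQ, Matrix.det_apply]
    refine Polynomial.natDegree_sum_le_of_forall_le _ _ fun σ _ => ?_
    refine (Polynomial.natDegree_smul_le _ _).trans ?_
    refine (Polynomial.natDegree_prod_le _ _).trans ?_
    rw [← Fin.sum_univ_eq_sum_range, ← Equiv.sum_comp σ (fun i : Fin m => e i)]
    exact Finset.sum_le_sum fun i _ => he _ _
  by_cases hQ0 : Q = 0
  · left
    ext τ
    rw [hW, hQ0]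
    simp
  · right
    calc _ ≤ ((Q.roots.toFinset : Set ℝ)).encard := by
          refine Set.encard_le_encard_of_injOn (f := Real.sigmoid) (fun τ hτ => ?_)
            Real.sigmoid_injective.injOn
          have hτ' : seqWronskian (fun j => sigmoidMonomial (α j) (β j)) m τ = 0 := hτ
          rw [hW] at hτ'
          simpa [hQ0] using (mul_eq_zero.1 hτ').resolve_left (hprod τ)
      _ = (Q.roots.toFinset.card : ℕ∞) := Set.encard_coe_eq_coe_finsetCard _
      _ ≤ _ := by
          exact_mod_cast (Multiset.toFinset_card_le _).trans ((Polynomial.card_roots' Q).trans hdeg)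

theorem cast_sum_range_id (m : ℕ) : ((∑ i ∈ Finset.range m, i : ℕ) : ℝ) = m * (m - 1) / 2 := by
  induction m with
  | zero => simp
  | succ m ih => rw [Finset.sum_range_succ, Nat.cast_add, ih]; push_cast; ring

theorem encard_zeros_sum_sigmoidMonomial_le {t : ℕ} (ht : 0 < t) (c α β : Fin t → ℝ) :
    (∀ τ, ∑ j, c j * sigmoidMonomial (α j) (β j) τ = 0) ∨
      ∃ N : ℕ, {τ | ∑ j, c j * sigmoidMonomial (α j) (β j) τ = 0}.encard ≤ N ∧
        (N : ℝ) ≤ 1 / 3 * (t : ℝ) ^ 3 - (t : ℝ) ^ 2 + 8 / 3 * (t : ℝ) - 2 := by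
  have : Nonempty (Fin t) := ⟨⟨0, ht⟩⟩
  refine (encard_zeros_sum_le (fun j => analyticOnNhd_sigmoidMonomial (α j) (β j))
    (fun m => ∑ i ∈ Finset.range m, i)
    (fun σ m => seqWronskian_sigmoidMonomial_eq_zero_or (α := fun j => α (σ j))
      (β := fun j => β (σ j)) (e := id) (fun i j => natDegree_sigmoidJet_le _ _ i) m) c).imp_right ?_
  rintro ⟨k, hk, hle⟩
  refine ⟨_, hle, ?_⟩
  rw [Fintype.card_fin] at hk
  have hval : ∀ k : ℕ, ((∑ i ∈ Finset.range k, (1 + (∑ l ∈ Finset.range (i + 1), l) +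
      ∑ l ∈ Finset.range i, l) + ∑ l ∈ Finset.range (k + 1), l : ℕ) : ℝ) =
      1 / 3 * ((k : ℝ) + 1) ^ 3 - ((k : ℝ) + 1) ^ 2 + 8 / 3 * ((k : ℝ) + 1) - 2 := by
    intro k
    have h1 : ((∑ i ∈ Finset.range k, (1 + (∑ l ∈ Finset.range (i + 1), l) +
        ∑ l ∈ Finset.range i, l) : ℕ) : ℝ) = k + k * (k - 1) * (2 * k - 1) / 6 := by
      induction k with
      | zero => simp
      | succ k ih =>
        rw [Finset.sum_range_succ, Nat.cast_add, ih]
        rw [Nat.cast_add, Nat.cast_add, cast_sum_range_id, cast_sum_range_id]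
        push_cast
        ring
    rw [Nat.cast_add, h1, cast_sum_range_id]
    push_cast
    ring
  rw [hval]
  have hkt : (k : ℝ) + 1 ≤ t := by exact_mod_cast hk
  have hk0 : (0 : ℝ) ≤ k := Nat.cast_nonneg k
  nlinarith [mul_nonneg (sub_nonneg.2 hkt) (sq_nonneg ((k : ℝ) + 1 + t - 2)),
    mul_nonneg (sub_nonneg.2 hkt) (sq_nonneg ((t : ℝ) - (k + 1)))]

theorem encard_zeros_sum_exp_le {t : ℕ} (ht : 0 < t) (c α : Fin t → ℝ) :
    (∀ y, ∑ j, c j * Real.exp (α j * y) = 0) ∨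
      {y | ∑ j, c j * Real.exp (α j * y) = 0}.encard ≤ ((t - 1 : ℕ) : ℕ∞) := by
  have : Nonempty (Fin t) := ⟨⟨0, ht⟩⟩
  simp only [← sigmoidMonomial_neg]
  refine (encard_zeros_sum_le (fun j => analyticOnNhd_sigmoidMonomial (α j) (-α j))
    (fun m => ∑ i ∈ Finset.range m, 0)
    (fun σ m => seqWronskian_sigmoidMonomial_eq_zero_or (α := fun j => α (σ j))
      (β := fun j => -α (σ j)) (e := fun _ => 0) (fun i j => natDegree_sigmoidJet_neg _ i) m)
      c).imp_right ?_
  rintro ⟨k, hk, hle⟩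
  rw [Fintype.card_fin] at hk
  refine hle.trans ?_
  simp only [Finset.sum_const_zero, add_zero, Finset.sum_const, Finset.card_range, smul_eq_mul,
    mul_one]
  exact_mod_cast (by omega : k ≤ t - 1)

/-! ### Logarithmic coordinates on the positive quadrant -/

/-- For linearly independent `u` and `v`, the monomials with exponents `u` and `v` give coordinates
on the positive quadrant: with `p` the pair of their logarithms, every monomial is the exponential
of a linear form in `p`. -/
theorem exists_log_coordinates {u v : Fin 2 → ℝ} (h : u 0 * v 1 - u 1 * v 0 ≠ 0) :
    ∃ (e : ℝ × ℝ → Fin 2 → ℝ) (w z : Fin 2 → ℝ), Function.Injective e ∧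
      Set.range e = {x | ∀ i, 0 < x i} ∧
      (∀ p b, genMonomial (e p) b = Real.exp (p.1 * b ⬝ᵥ w + p.2 * b ⬝ᵥ z)) ∧
      u ⬝ᵥ w = 1 ∧ u ⬝ᵥ z = 0 ∧ v ⬝ᵥ w = 0 ∧ v ⬝ᵥ z = 1 := by
  set Δ := u 0 * v 1 - u 1 * v 0 with hΔ
  set w : Fin 2 → ℝ := ![v 1 / Δ, -v 0 / Δ] with hw
  set z : Fin 2 → ℝ := ![-u 1 / Δ, u 0 / Δ] with hz
  have huw : u ⬝ᵥ w = 1 := by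
    simp only [dotProduct, Fin.sum_univ_two, hw, Matrix.cons_val_zero, Matrix.cons_val_one]
    field_simp
    rw [hΔ]; ring
  have huz : u ⬝ᵥ z = 0 := by
    simp only [dotProduct, Fin.sum_univ_two, hz, Matrix.cons_val_zero, Matrix.cons_val_one]
    field_simp
    ring
  have hvw : v ⬝ᵥ w = 0 := by
    simp only [dotProduct, Fin.sum_univ_two, hw, Matrix.cons_val_zero, Matrix.cons_val_one]
    field_simp
    ring
  have hvz : v ⬝ᵥ z = 1 := by
    simp only [dotProduct, Fin.sum_univ_two, hz, Matrix.cons_val_zero, Matrix.cons_val_one]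
    field_simp
    rw [hΔ]; ring
  set e : ℝ × ℝ → Fin 2 → ℝ := fun p i => Real.exp (p.1 * w i + p.2 * z i) with he
  have hmon : ∀ p b, genMonomial (e p) b = Real.exp (p.1 * b ⬝ᵥ w + p.2 * b ⬝ᵥ z) := by
    intro p b
    simp only [genMonomial, he, ← Real.exp_mul, ← Real.exp_add, Fin.prod_univ_two, dotProduct,
      Fin.sum_univ_two]
    congr 1
    ring
  refine ⟨e, w, z, ?_, ?_, hmon, huw, huz, hvw, hvz⟩
  · intro p q hpq
    have h1 := hmon p u
    have h2 := hmon p v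
    rw [hpq, hmon] at h1 h2
    simp only [huw, huz, hvw, hvz, mul_one, mul_zero, add_zero, zero_add] at h1 h2
    exact Prod.ext (Real.exp_injective h1).symm (Real.exp_injective h2).symm
  · refine Set.Subset.antisymm ?_ fun x hx => ?_
    · rintro _ ⟨p, rfl⟩ i
      exact Real.exp_pos _
    · refine ⟨(u 0 * Real.log (x 0) + u 1 * Real.log (x 1),
        v 0 * Real.log (x 0) + v 1 * Real.log (x 1)), ?_⟩
      ext i
      refine (congrArg Real.exp ?_).trans (Real.exp_log (hx i))
      fin_cases i
      · simp only [hw, hz, Fin.zero_eta, Matrix.cons_val_zero]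
        field_simp
        rw [hΔ]; ring
      · simp only [hw, hz, Fin.mk_one, Matrix.cons_val_one, Matrix.cons_val_fin_one]
        field_simp
        rw [hΔ]; ring

theorem genPolynomial_comp_perm {n t : ℕ} (σ : Equiv.Perm (Fin t)) (a : Fin t → ℝ)
    (b : Fin t → Fin n → ℝ) : genPolynomial (a ∘ σ) (b ∘ σ) = genPolynomial a b := by
  ext x
  exact Equiv.sum_comp σ fun j => a j * genMonomial x (b j)

theorem genPolynomial_fin_three_eq_zero_iff {n : ℕ} (a : Fin 3 → ℝ) (b : Fin 3 → Fin n → ℝ)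
    {x : Fin n → ℝ} {r s : ℝ} (hx : 0 < genMonomial x (b 0))
    (hr : genMonomial x (b 1) = genMonomial x (b 0) * r)
    (hs : genMonomial x (b 2) = genMonomial x (b 0) * s) :
    genPolynomial a b x = 0 ↔ a 0 + a 1 * r + a 2 * s = 0 := by
  have : genPolynomial a b x = genMonomial x (b 0) * (a 0 + a 1 * r + a 2 * s) := by
    rw [genPolynomial, Fin.sum_univ_three, hr, hs]
    ring
  rw [this, mul_eq_zero, or_iff_right hx.ne']

/-! ### Trinomials with linearly independent exponent differences -/

/-- If the first coefficient of the trinomial is opposed in sign to the other two, its zero set is a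
curve with parameter `τ`: after division by the first monomial it reads `s + (1 - s) = 1`, where
`s = Real.sigmoid τ`. On this curve every monomial is a multiple of a `sigmoidMonomial`. -/
theorem positiveSolutions_infinite_or_le_of_independent {t : ℕ} (ht : 0 < t)
    (a' : Fin 3 → ℝ) (b' : Fin 3 → Fin 2 → ℝ) (a : Fin t → ℝ) (b : Fin t → Fin 2 → ℝ)
    (h1 : a' 0 * a' 1 < 0) (h2 : a' 0 * a' 2 < 0)
    (hb : (b' 1 - b' 0) 0 * (b' 2 - b' 0) 1 - (b' 1 - b' 0) 1 * (b' 2 - b' 0) 0 ≠ 0) :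
    (positiveSolutions a' b' a b).Infinite ∨
      ∃ N : ℕ, (positiveSolutions a' b' a b).encard ≤ N ∧
        (N : ℝ) ≤ 1 / 3 * (t : ℝ) ^ 3 - (t : ℝ) ^ 2 + 8 / 3 * (t : ℝ) - 2 := by
  obtain ⟨e, w, z, hinj, hrange, hmon, huw, huz, hvw, hvz⟩ := exists_log_coordinates hb
  have ha0 : a' 0 ≠ 0 := by rintro h; simp [h] at h1
  have hp : 0 < -(a' 1 / a' 0) := by
    rw [neg_pos, div_neg_iff]; rcases mul_neg_iff.1 h1 with h | h <;> tauto
  have hq : 0 < -(a' 2 / a' 0) := by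
    rw [neg_pos, div_neg_iff]; rcases mul_neg_iff.1 h2 with h | h <;> tauto
  set p := -(a' 1 / a' 0) with hpdef
  set q := -(a' 2 / a' 0) with hqdef
  have htri : ∀ y : ℝ × ℝ, genPolynomial a' b' (e y) = 0 ↔
      p * Real.exp y.1 + q * Real.exp y.2 = 1 := by
    intro y
    rw [genPolynomial_fin_three_eq_zero_iff a' b' (r := Real.exp y.1) (s := Real.exp y.2)
      (by rw [hmon]; exact Real.exp_pos _)]
    · rw [hpdef, hqdef]
      field_simp
      constructor <;> intro h <;> linarith
    · rw [sub_dotProduct, sub_eq_iff_eq_add] at huw huz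
      rw [hmon, hmon, ← Real.exp_add, huw, huz]
      ring_nf
    · rw [sub_dotProduct, sub_eq_iff_eq_add] at hvw hvz
      rw [hmon, hmon, ← Real.exp_add, hvw, hvz]
      ring_nf
  set γ : ℝ → ℝ × ℝ := fun τ => (Real.log (Real.sigmoid τ) - Real.log p,
    Real.log (Real.sigmoid (-τ)) - Real.log q) with hγ
  have hγinj : Function.Injective γ := by
    intro τ τ' h
    have := (Prod.ext_iff.1 h).1
    simp only [hγ, sub_left_inj] at this
    exact Real.sigmoid_injective (Real.log_injOn_pos (Real.sigmoid_pos _) (Real.sigmoid_pos _) this)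
  have hγrange : ∀ y : ℝ × ℝ, p * Real.exp y.1 + q * Real.exp y.2 = 1 ↔ y ∈ Set.range γ := by
    intro y
    constructor
    · intro h
      have hy1 : 0 < p * Real.exp y.1 := mul_pos hp (Real.exp_pos _)
      have hy2 : 0 < q * Real.exp y.2 := mul_pos hq (Real.exp_pos _)
      obtain ⟨τ, hτ⟩ : p * Real.exp y.1 ∈ Set.range Real.sigmoid := by
        rw [Real.range_sigmoid]
        exact ⟨hy1, by linarith⟩
      refine ⟨τ, Prod.ext ?_ ?_⟩
      · simp only [hγ]
        rw [hτ, Real.log_mul hp.ne' (Real.exp_ne_zero _), Real.log_exp]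
        ring
      · simp only [hγ]
        rw [Real.sigmoid_neg, hτ, ← h, add_sub_cancel_left,
          Real.log_mul hq.ne' (Real.exp_ne_zero _), Real.log_exp]
        ring
    · rintro ⟨τ, rfl⟩
      simp only [hγ, Real.exp_sub, Real.exp_log hp, Real.exp_log hq,
        Real.exp_log (Real.sigmoid_pos _), Real.sigmoid_neg]
      rw [Real.exp_log (by rw [← Real.sigmoid_neg]; exact Real.sigmoid_pos _)]
      field_simp
      ring
  set c : Fin t → ℝ := fun j =>
    a j * Real.exp (-(Real.log p * b j ⬝ᵥ w) - Real.log q * b j ⬝ᵥ z) with hc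
  have hF : ∀ τ, genPolynomial a b (e (γ τ)) =
      ∑ j, c j * sigmoidMonomial (b j ⬝ᵥ w) (b j ⬝ᵥ z) τ := by
    intro τ
    refine Finset.sum_congr rfl fun j _ => ?_
    rw [hmon, hc, sigmoidMonomial, mul_assoc, ← Real.exp_add]
    congr 2
    simp only [hγ]
    ring
  have hS : positiveSolutions a' b' a b = (fun τ => e (γ τ)) ''
      {τ | ∑ j, c j * sigmoidMonomial (b j ⬝ᵥ w) (b j ⬝ᵥ z) τ = 0} := by
    ext x
    constructor
    · rintro ⟨hx, hx1, hx2⟩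
      obtain ⟨y, rfl⟩ : x ∈ Set.range e := by rw [hrange]; exact hx
      obtain ⟨τ, rfl⟩ := (hγrange y).1 ((htri y).1 hx1)
      exact ⟨τ, (hF τ).symm.trans hx2, rfl⟩
    · rintro ⟨τ, hτ, rfl⟩
      refine ⟨?_, (htri _).2 ((hγrange _).2 ⟨τ, rfl⟩), (hF τ).trans hτ⟩
      have : e (γ τ) ∈ Set.range e := ⟨_, rfl⟩
      rwa [hrange] at this
  have hcomp : Function.Injective fun τ => e (γ τ) := hinj.comp hγinj
  rcases encard_zeros_sum_sigmoidMonomial_le ht c (fun j => b j ⬝ᵥ w) (fun j => b j ⬝ᵥ z) with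
    h | ⟨N, hN, hle⟩
  · left
    rw [hS]
    simp only [h, Set.ofPred_true]
    exact Set.infinite_univ.image hcomp.injOn
  · right
    refine ⟨N, ?_, hle⟩
    rw [hS, hcomp.encard_image]
    exact hN

/-! ### Trinomials with collinear exponents -/

/-- Here the trinomial is a function of one monomial, with at most two zeros; on the corresponding
level sets the other equation is an exponential sum in one variable. -/
theorem positiveSolutions_infinite_or_le_of_collinear {t : ℕ} (ht : 0 < t)
    (a' : Fin 3 → ℝ) (b' : Fin 3 → Fin 2 → ℝ) (h' : IsNomial a' b')
    (a : Fin t → ℝ) (b : Fin t → Fin 2 → ℝ)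
    (hb : (b' 1 - b' 0) 0 * (b' 2 - b' 0) 1 - (b' 1 - b' 0) 1 * (b' 2 - b' 0) 0 = 0) :
    (positiveSolutions a' b' a b).Infinite ∨
      (positiveSolutions a' b' a b).encard ≤ ((2 * (t - 1) : ℕ) : ℕ∞) := by
  set u := b' 1 - b' 0 with hu
  have hu0 : u ≠ 0 := sub_ne_zero.2 (h'.2.ne (by decide))
  have hv0 : b' 2 - b' 0 ≠ 0 := sub_ne_zero.2 (h'.2.ne (by decide))
  have hsq : u 0 ^ 2 + u 1 ^ 2 ≠ 0 := by
    intro h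
    have e0 : u 0 = 0 := by nlinarith [sq_nonneg (u 0), sq_nonneg (u 1)]
    have e1 : u 1 = 0 := by nlinarith [sq_nonneg (u 0), sq_nonneg (u 1)]
    exact hu0 (funext fun i => by fin_cases i <;> assumption)
  obtain ⟨r, hr⟩ : ∃ r : ℝ, b' 2 - b' 0 = r • u := by
    set v := b' 2 - b' 0
    refine ⟨(u 0 * v 0 + u 1 * v 1) / (u 0 ^ 2 + u 1 ^ 2), funext fun i => ?_⟩
    fin_cases i
    · simp only [Fin.zero_eta, Pi.smul_apply, smul_eq_mul]
      field_simp
      linear_combination -u 1 * hb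
    · simp only [Fin.mk_one, Pi.smul_apply, smul_eq_mul]
      field_simp
      linear_combination u 0 * hb
  have hr0 : r ≠ 0 := by
    rintro rfl
    exact hv0 (by rw [hr, zero_smul])
  have hr1 : r ≠ 1 := by
    rintro rfl
    rw [one_smul, hu, sub_left_inj] at hr
    exact absurd (h'.2 hr) (by decide)
  obtain ⟨e, w, z, hinj, hrange, hmon, huw, huz, -, -⟩ :=
    exists_log_coordinates (u := u) (v := ![-u 1, u 0]) (by
      simp only [Matrix.cons_val_zero, Matrix.cons_val_one]
      convert hsq using 1
      ring)
  set α : Fin 3 → ℝ := ![0, 1, r] with hα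
  have htri : ∀ y : ℝ × ℝ, genPolynomial a' b' (e y) = 0 ↔
      ∑ j, a' j * Real.exp (α j * y.1) = 0 := by
    intro y
    have hvw : (b' 2 - b' 0) ⬝ᵥ w = r := by rw [hr, smul_dotProduct, huw, smul_eq_mul, mul_one]
    have hvz : (b' 2 - b' 0) ⬝ᵥ z = 0 := by rw [hr, smul_dotProduct, huz, smul_eq_mul, mul_zero]
    rw [genPolynomial_fin_three_eq_zero_iff a' b' (r := Real.exp y.1) (s := Real.exp (r * y.1))
      (by rw [hmon]; exact Real.exp_pos _)]
    · simp [Fin.sum_univ_three, hα]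
    · rw [hu, sub_dotProduct, sub_eq_iff_eq_add] at huw huz
      rw [hmon, hmon, ← Real.exp_add, huw, huz]
      ring_nf
    · rw [sub_dotProduct, sub_eq_iff_eq_add] at hvw hvz
      rw [hmon, hmon, ← Real.exp_add, hvw, hvz]
      ring_nf
  set Z : Set ℝ := {P | ∑ j, a' j * Real.exp (α j * P) = 0} with hZ
  have hZle : Z.encard ≤ ((2 : ℕ) : ℕ∞) := by
    refine (encard_zeros_sum_exp_le (t := 3) (by norm_num) a' α).resolve_left fun h0 => ?_
    have hder : ∀ (c : Fin 3 → ℝ), (∀ y, ∑ j, c j * Real.exp (α j * y) = 0) →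
        ∀ y, ∑ j, (c j * α j) * Real.exp (α j * y) = 0 := by
      intro c hc y
      have hd : HasDerivAt (fun y => ∑ j, c j * Real.exp (α j * y))
          (∑ j, c j * (Real.exp (α j * y) * (α j * 1))) y :=
        HasDerivAt.fun_sum fun j _ => (((hasDerivAt_id y).const_mul (α j)).exp).const_mul (c j)
      have hc' : (fun y => ∑ j, c j * Real.exp (α j * y)) = fun _ => 0 := funext hc
      rw [hc'] at hd
      exact (Finset.sum_congr rfl fun j _ => by ring).trans
        (hd.unique (hasDerivAt_const y (0 : ℝ)))
    have e1 := hder _ h0 0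
    have e2 := hder _ (hder _ h0) 0
    simp only [Fin.sum_univ_three, hα, Matrix.cons_val_zero, Matrix.cons_val_one, Matrix.cons_val,
      mul_zero, Real.exp_zero, mul_one, zero_add] at e1 e2
    have e3 : a' 2 * (r * (r - 1)) = 0 := by linear_combination e2 - e1
    exact mul_ne_zero (h'.1 2) (mul_ne_zero hr0 (sub_ne_zero.2 hr1)) e3
  have hZfin : Z.Finite := Set.finite_of_encard_le_coe hZle
  set T : ℝ → Set ℝ := fun P =>
    {y | ∑ j, (a j * Real.exp (P * b j ⬝ᵥ w)) * Real.exp (b j ⬝ᵥ z * y) = 0} with hT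
  have hF : ∀ P y, genPolynomial a b (e (P, y)) =
      ∑ j, (a j * Real.exp (P * b j ⬝ᵥ w)) * Real.exp (b j ⬝ᵥ z * y) := by
    intro P y
    refine Finset.sum_congr rfl fun j _ => ?_
    rw [hmon, Real.exp_add, mul_assoc, mul_comm y]
  have hS : positiveSolutions a' b' a b = ⋃ P ∈ Z, (fun y => e (P, y)) '' T P := by
    ext x
    simp only [Set.mem_iUnion, exists_prop]
    constructor
    · rintro ⟨hx, hx1, hx2⟩
      obtain ⟨⟨P, y⟩, rfl⟩ : x ∈ Set.range e := by rw [hrange]; exact hx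
      exact ⟨P, (htri _).1 hx1, y, (hF P y).symm.trans hx2, rfl⟩
    · rintro ⟨P, hP, y, hy, rfl⟩
      refine ⟨?_, (htri _).2 hP, (hF P y).trans hy⟩
      have : e (P, y) ∈ Set.range e := ⟨_, rfl⟩
      rwa [hrange] at this
  have hinjP : ∀ P, Function.Injective fun y => e (P, y) := fun P y y' h =>
    (Prod.ext_iff.1 (hinj h)).2
  by_cases hinf : ∃ P ∈ Z, ∀ y, y ∈ T P
  · obtain ⟨P, hP, hPT⟩ := hinf
    left
    refine Set.Infinite.mono (s := (fun y => e (P, y)) '' T P) ?_ ?_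
    · rw [hS]
      exact Set.subset_biUnion_of_mem (u := fun P => (fun y => e (P, y)) '' T P) hP
    · rw [Set.eq_univ_of_forall hPT]
      exact Set.infinite_univ.image (hinjP P).injOn
  · right
    push Not at hinf
    have hTle : ∀ P ∈ Z, ((fun y => e (P, y)) '' T P).encard ≤ ((t - 1 : ℕ) : ℕ∞) := by
      intro P hP
      rw [(hinjP P).encard_image]
      obtain ⟨y, hy⟩ := hinf P hP
      exact (encard_zeros_sum_exp_le ht (fun j => a j * Real.exp (P * b j ⬝ᵥ w))
        (fun j => b j ⬝ᵥ z)).resolve_left fun h => hy (h y)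
    classical
    have hZcard : hZfin.toFinset.card ≤ 2 := by
      rw [hZfin.encard_eq_coe_toFinset_card] at hZle
      exact_mod_cast hZle
    have hSfin : ∀ P ∈ Z, ((fun y => e (P, y)) '' T P).Finite := fun P hP =>
      Set.finite_of_encard_le_coe (hTle P hP)
    let U : ℝ → Finset (Fin 2 → ℝ) := fun P =>
      if hP : P ∈ Z then (hSfin P hP).toFinset else ∅
    have hU : ∀ P ∈ hZfin.toFinset, (U P).card ≤ t - 1 := by
      intro P hP
      have hPZ := hZfin.mem_toFinset.1 hP
      have := hTle P hPZ
      rw [(hSfin P hPZ).encard_eq_coe_toFinset_card] at this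
      simp only [U, dif_pos hPZ]
      exact_mod_cast this
    have hSU : positiveSolutions a' b' a b ⊆ (hZfin.toFinset.biUnion U : Finset (Fin 2 → ℝ)) := by
      rw [hS]
      intro x hx
      simp only [Set.mem_iUnion, exists_prop] at hx
      obtain ⟨P, hP, hxP⟩ := hx
      rw [Finset.mem_coe, Finset.mem_biUnion]
      exact ⟨P, hZfin.mem_toFinset.2 hP, by simpa only [U, dif_pos hP, Set.Finite.mem_toFinset]⟩
    refine (Set.encard_le_encard hSU).trans ?_
    rw [Set.encard_coe_eq_coe_finsetCard]
    exact_mod_cast (Finset.card_biUnion_le_card_mul _ _ _ hU).trans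
      (Nat.mul_le_mul_right _ hZcard)

/-! ### Systems of a trinomial and a `t`-nomial -/

theorem mainTheorem4 (t : ℕ) (ht : 3 ≤ t)
    (a' : Fin 3 → ℝ) (b' : Fin 3 → Fin 2 → ℝ) (h' : IsNomial a' b')
    (a : Fin t → ℝ) (b : Fin t → Fin 2 → ℝ) (h : IsNomial a b) :
    (positiveSolutions a' b' a b).Infinite ∨
      ((positiveSolutions a' b' a b).Finite ∧
        ((positiveSolutions a' b' a b).ncard : ℝ) ≤
          1 / 3 * (t : ℝ) ^ 3 - (t : ℝ) ^ 2 + 8 / 3 * (t : ℝ) - 2) := by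
  have ht3 : (3 : ℝ) ≤ t := by exact_mod_cast ht
  have hcub : (2 * ((t : ℝ) - 1)) ≤
      1 / 3 * (t : ℝ) ^ 3 - (t : ℝ) ^ 2 + 8 / 3 * (t : ℝ) - 2 := by
    nlinarith [mul_nonneg (mul_nonneg (sub_nonneg.2 ht3) (by linarith : (0 : ℝ) ≤ t))
      (by linarith : (0 : ℝ) ≤ t)]
  suffices hmain : (positiveSolutions a' b' a b).Infinite ∨
      ∃ N : ℕ, (positiveSolutions a' b' a b).encard ≤ N ∧
        (N : ℝ) ≤ 1 / 3 * (t : ℝ) ^ 3 - (t : ℝ) ^ 2 + 8 / 3 * (t : ℝ) - 2 by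
    refine hmain.imp_right ?_
    rintro ⟨N, hN, hle⟩
    refine ⟨Set.finite_of_encard_le_coe hN, le_trans ?_ hle⟩
    rw [← (Set.finite_of_encard_le_coe hN).cast_ncard_eq] at hN
    exact_mod_cast hN
  by_cases hb : (b' 1 - b' 0) 0 * (b' 2 - b' 0) 1 - (b' 1 - b' 0) 1 * (b' 2 - b' 0) 0 = 0
  · refine (positiveSolutions_infinite_or_le_of_collinear (by omega) a' b' h' a b hb).imp_right
      fun hle => ⟨_, hle, ?_⟩
    rw [Nat.cast_mul, Nat.cast_sub (by omega)]
    simpa using hcub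
  -- For independent exponent differences, a permutation of the three terms puts the
  -- coefficient of the exceptional sign first.
  have hperm : ∀ σ : Equiv.Perm (Fin 3),
      positiveSolutions (a' ∘ σ) (b' ∘ σ) a b = positiveSolutions a' b' a b := by
    intro σ
    simp only [positiveSolutions, genPolynomial_comp_perm]
  have key : ∀ σ : Equiv.Perm (Fin 3), a' (σ 0) * a' (σ 1) < 0 → a' (σ 0) * a' (σ 2) < 0 →
      (b' (σ 1) - b' (σ 0)) 0 * (b' (σ 2) - b' (σ 0)) 1 -
        (b' (σ 1) - b' (σ 0)) 1 * (b' (σ 2) - b' (σ 0)) 0 ≠ 0 → _ := fun σ hs1 hs2 hd =>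
    hperm σ ▸ positiveSolutions_infinite_or_le_of_independent (by omega) (a' ∘ σ) (b' ∘ σ) a b
      hs1 hs2 hd
  simp only [Pi.sub_apply] at hb key
  by_cases hs1 : a' 0 * a' 1 < 0 <;> by_cases hs2 : a' 0 * a' 2 < 0
  · exact key 1 hs1 hs2 hb
  · have hpos : 0 < a' 0 * a' 2 :=
      lt_of_le_of_ne (not_lt.1 hs2) (mul_ne_zero (h'.1 0) (h'.1 2)).symm
    have hs3 : a' 1 * a' 2 < 0 := by
      by_contra! hn
      linarith [mul_nonneg (sq_nonneg (a' 0)) hn, mul_neg_of_neg_of_pos hs1 hpos]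
    have e2 : Equiv.swap (0 : Fin 3) 1 2 = 2 := by decide
    refine key (Equiv.swap 0 1) ?_ ?_ fun hd => hb ?_
    · rwa [Equiv.swap_apply_left, Equiv.swap_apply_right, mul_comm]
    · rwa [Equiv.swap_apply_left, e2]
    · rw [Equiv.swap_apply_left, Equiv.swap_apply_right, e2] at hd
      linear_combination -hd
  · have hpos : 0 < a' 0 * a' 1 :=
      lt_of_le_of_ne (not_lt.1 hs1) (mul_ne_zero (h'.1 0) (h'.1 1)).symm
    have hs3 : a' 2 * a' 1 < 0 := by
      by_contra! hn
      linarith [mul_nonneg (sq_nonneg (a' 0)) hn, mul_neg_of_neg_of_pos hs2 hpos]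
    have e1 : Equiv.swap (0 : Fin 3) 2 1 = 1 := by decide
    refine key (Equiv.swap 0 2) ?_ ?_ fun hd => hb ?_
    · rwa [Equiv.swap_apply_left, e1]
    · rwa [Equiv.swap_apply_left, Equiv.swap_apply_right, mul_comm]
    · rw [Equiv.swap_apply_left, Equiv.swap_apply_right, e1] at hd
      linear_combination -hd
  · -- All three coefficients have the same sign, so the trinomial has no positive zeros.
    have hempty : positiveSolutions a' b' a b = ∅ := by
      refine Set.eq_empty_of_forall_notMem fun x hx => ?_
      obtain ⟨hx, hx1, -⟩ := hx
      have hM : ∀ j, 0 < genMonomial x (b' j) := fun j =>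
        Finset.prod_pos fun i _ => Real.rpow_pos_of_pos (hx i) _
      rw [genPolynomial, Fin.sum_univ_three] at hx1
      have h3 := mul_pos (sq_pos_of_ne_zero (h'.1 0)) (hM 0)
      have h4 := mul_nonneg (not_lt.1 hs1) (hM 1).le
      have h5 := mul_nonneg (not_lt.1 hs2) (hM 2).le
      have h6 := congrArg (a' 0 * ·) hx1
      simp only [mul_zero] at h6
      linarith
    refine Or.inr ⟨0, by simp [hempty], ?_⟩
    rw [Nat.cast_zero]
    linarith
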